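/- Let $k\ge 0$ be an integer, $H_k=\sum_{i=1}^k 1/i$ (with $H_0=0$), $B_n$ the Bernoulli numbers ($B_1=-\tfrac12$) and $B_n(x)$ the Bernoulli polynomials. For real $w>0$ let $\zeta(s,w)$ be the Hurwitz zeta function, the meromorphic continuation in $s$ of $\sum_{n\ge0}(n+w)^{-s}$; let $\zeta(s)=\zeta(s,1)$, and let $'$ denote $\partial/\partial s$. Say that $f(x)$ has constant term $c$ as $x\to\infty$ if there are real polynomials $P,Q$ with $Q(0)=0$ such that $f(x)-P(x)\log x-Q(x)\to c$; such a $c$ is unique. Let $L_k=\log A_k$ be the constant term of $\sum_{m=1}^n m^k\log m$ as $n\to\infty$ through the integers ($A_k$ is the $k$-th Glaisher–Kinkelin–Bendersky constant). Bendersky's generalised gamma function $\Gamma_k$ is defined for real $x>-1$ by $$\log\Gamma_k(x+1)=k!\,I_k(x)+H_k\,\phi_k(x+1)-\sum_{r=0}^{k-1}\binom kr L_r\,x^{k-r},$$ where $I_0(x)=\log\Gamma(x+1)$, $I_j(x)=\int_0^x I_{j-1}(t)\,dt$ and $\phi_k(x)=\frac{B_{k+1}(x)-B_{k+1}}{k+1}$.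 Put $\Lambda_k(w)=\log\Gamma_k(w)-L_k$ for real $w>0$. Then: 1. The constant term $L_k$ exists, and $\log\Gamma_k(n+1)=\sum_{m=1}^n m^k\log m$ for every integer $n\ge0$. 2. $\log\Gamma_k(x+1)=L_k+\Lambda_k(x+1)$ for all real $x>-1$, and $\Lambda_k(x+1)$ has constant term $0$ as $x\to\infty$ through the reals. 3. $\displaystyle \zeta'(-k)=\frac{H_kB_{k+1}}{k+1}-\log A_k$. 4. For every real $w>0$, $\zeta'(-k,w)-\zeta'(-k)=\log\Gamma_k(w)$ and $$\zeta'(-k,w)=\frac{H_kB_{k+1}}{k+1}-L_k+\log\Gamma_k(w)=\frac{H_kB_{k+1}}{k+1}+\Lambda_k(w).$$ -/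

import Mathlib

open Filter Topology

namespace GKB

noncomputable section

/-- The Hurwitz zeta function `ζ(s, w)` for real `w > 0`: the meromorphic continuation in `s` of
`∑_{n ≥ 0} (n + w)^{-s}`. Mathlib's `HurwitzZeta.hurwitzZeta` only depends on `w` modulo `1`
and is the desired function for `0 < w ≤ 1`; for larger `w` the terms with base
`w - 1, w - 2, …` in `(0, w)` are removed. See `hasSum_hurwitz` and `differentiableAt_hurwitz`. -/
def hurwitz (w : ℝ) (s : ℂ) : ℂ :=
  HurwitzZeta.hurwitzZeta (w : UnitAddCircle) s -
    ∑ j ∈ Finset.range (⌈w⌉₊ - 1), 1 / (((w - (j + 1) : ℝ) : ℂ)) ^ s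

/-- `hurwitz w` is given by the Hurwitz series on its half-plane of convergence. -/
theorem hasSum_hurwitz {w : ℝ} (hw : 0 < w) {s : ℂ} (hs : 1 < s.re) :
    HasSum (fun n : ℕ => 1 / ((n : ℂ) + (w : ℂ)) ^ s) (hurwitz w s) := by
  obtain ⟨m, hm⟩ : ∃ m : ℕ, ⌈w⌉₊ = m + 1 :=
    ⟨⌈w⌉₊ - 1, by have := Nat.ceil_pos.2 hw; omega⟩
  have h1 : w ≤ m + 1 := by have := Nat.le_ceil w; rw [hm] at this; exact_mod_cast this
  have h2 : (m : ℝ) < w := by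
    have := (Nat.lt_ceil (a := w) (n := m)).1 (by omega)
    exact this
  have key := HurwitzZeta.hasSum_hurwitzZeta_of_one_lt_re (a := w - m)
    ⟨by linarith, by linarith⟩ hs
  have hcirc : ((w - m : ℝ) : UnitAddCircle) = (w : UnitAddCircle) := by
    have : ((m : ℝ) : UnitAddCircle) = 0 := by
      have := AddCircle.coe_nsmul (p := (1 : ℝ)) (n := m) (x := 1)
      simpa [AddCircle.coe_period] using this
    rw [AddCircle.coe_sub, this, sub_zero]
  rw [hcirc] at key
  have key2 := (hasSum_nat_add_iff' m).2 key
  unfold hurwitz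
  rw [hm, Nat.add_sub_cancel]
  have hsum : ∑ j ∈ Finset.range m, 1 / (((w - (j + 1) : ℝ) : ℂ)) ^ s =
      ∑ i ∈ Finset.range m, 1 / ((i : ℂ) + ((w - m : ℝ) : ℂ)) ^ s := by
    rw [← Finset.sum_range_reflect]
    refine Finset.sum_congr rfl fun j hj => ?_
    have hj' := Finset.mem_range.1 hj
    have h3 : ((m - 1 - j : ℕ) : ℝ) = m - 1 - j := by
      rw [Nat.cast_sub (by omega), Nat.cast_sub (by omega)]; simp
    congr 2
    rw [h3]
    push_cast
    ring
  have hfun : (fun n : ℕ => 1 / ((n : ℂ) + (w : ℂ)) ^ s) =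
      fun n : ℕ => 1 / (((n + m : ℕ) : ℂ) + ((w - m : ℝ) : ℂ)) ^ s := by
    funext n
    congr 2
    push_cast
    ring
  rw [hsum, hfun]
  exact key2

/-- `hurwitz w` is holomorphic on `ℂ \ {1}`; with `hasSum_hurwitz` this determines it there. -/
theorem differentiableAt_hurwitz {w : ℝ} {s : ℂ} (hs : s ≠ 1) :
    DifferentiableAt ℂ (hurwitz w) s := by
  unfold hurwitz
  refine (HurwitzZeta.differentiableAt_hurwitzZeta _ hs).sub
    (DifferentiableAt.fun_sum fun j hj => ?_)
  have hj' := Finset.mem_range.1 hj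
  have h3 : ((j + 1 : ℕ) : ℝ) < w := Nat.lt_ceil.1 (by omega)
  have h4 : ((w - (j + 1) : ℝ) : ℂ) ≠ 0 := by
    push_cast at h3
    exact Complex.ofReal_ne_zero.2 (by linarith)
  refine DifferentiableAt.div (by fun_prop)
    (DifferentiableAt.const_cpow differentiableAt_id (Or.inl h4)) ?_
  exact fun h => h4 ((Complex.cpow_eq_zero_iff _ _).1 h).1

/-- `c` is the `x`-independent term in the asymptotic behaviour of `f` as the variable `x` tends to
infinity (along the filter `l`): up to a remainder `o(1)`, `f` is `c` plus a linear combination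
of `x ^ j * log x` (`j ≥ 0`) and `x ^ j` (`j ≥ 1`). -/
def HasConstantTerm {ι : Type} (l : Filter ι) (x f : ι → ℝ) (c : ℝ) : Prop :=
  ∃ P Q : Polynomial ℝ, Q.coeff 0 = 0 ∧
    Tendsto (fun i => f i - (P.eval (x i) * Real.log (x i) + Q.eval (x i))) l (𝓝 c)

theorem tendsto_log_mul_eval (P : Polynomial ℝ) (d : ℕ) (hd : P.natDegree ≤ d) :
    Tendsto (fun y : ℝ => Real.log y * (P.eval y / y ^ d - P.coeff d)) atTop (𝓝 0) := by
  have h1 : ∀ i ∈ Finset.range d,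
      Tendsto (fun y : ℝ => P.coeff i * (Real.log y * (y ^ i / y ^ d))) atTop (𝓝 0) := by
    intro i hi
    have hi' := Finset.mem_range.1 hi
    have h2 : Tendsto (fun y : ℝ => Real.log y / y) atTop (𝓝 0) :=
      Real.isLittleO_log_id_atTop.tendsto_div_nhds_zero
    have h3 : Tendsto (fun y : ℝ => Real.log y * (y ^ i / y ^ d)) atTop (𝓝 0) := by
      refine squeeze_zero_norm' ?_ h2
      filter_upwards [eventually_ge_atTop (1 : ℝ)] with y hy
      have hl := Real.log_nonneg hy
      have hy0 : 0 < y := by linarith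
      rw [Real.norm_of_nonneg (by positivity), div_eq_mul_inv (Real.log y) y]
      refine mul_le_mul_of_nonneg_left ?_ hl
      rw [div_le_iff₀ (by positivity), ← div_eq_inv_mul, le_div_iff₀ hy0, ← pow_succ]
      exact pow_le_pow_right₀ hy (by omega)
    simpa using h3.const_mul (P.coeff i)
  have h4 := tendsto_finsetSum _ h1
  rw [Finset.sum_const_zero] at h4
  refine h4.congr' ?_
  filter_upwards [eventually_gt_atTop (0 : ℝ)] with y hy
  rw [Polynomial.eval_eq_sum_range' (Nat.lt_succ_of_le hd), Finset.sum_range_succ, add_div,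
    mul_div_assoc, div_self (by positivity), mul_one, add_sub_cancel_right, Finset.sum_div,
    Finset.mul_sum]
  exact Finset.sum_congr rfl fun i _ => by ring

/-- The constant term is unique. -/
theorem HasConstantTerm.unique {ι : Type} {l : Filter ι} [l.NeBot] {x f : ι → ℝ}
    (hx : Tendsto x l atTop) {c c' : ℝ} (h : HasConstantTerm l x f c)
    (h' : HasConstantTerm l x f c') : c = c' := by
  obtain ⟨P₁, Q₁, hQ₁, h₁⟩ := h
  obtain ⟨P₂, Q₂, hQ₂, h₂⟩ := h'
  by_contra hne
  set P := P₂ - P₁ with hP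
  set R := Q₂ - Q₁ - Polynomial.C (c - c') with hR
  have hR0 : R.coeff 0 ≠ 0 := by
    simp [hR, hQ₁, hQ₂, sub_ne_zero, Ne.symm hne]
  have hg : Tendsto (fun i => P.eval (x i) * Real.log (x i) + R.eval (x i)) l (𝓝 0) := by
    have := (h₁.sub h₂).sub_const (c - c')
    rw [sub_self] at this
    refine this.congr fun i => ?_
    simp only [hP, hR, Polynomial.eval_sub, Polynomial.eval_C]
    ring
  obtain ⟨d, hdP, hdR, hd⟩ : ∃ d, P.natDegree ≤ d ∧ R.natDegree ≤ d ∧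
      (P.coeff d ≠ 0 ∨ R.coeff d ≠ 0) := by
    have hRne : R ≠ 0 := fun h0 => hR0 (by simp [h0])
    rcases le_total P.natDegree R.natDegree with hle | hle
    · exact ⟨R.natDegree, hle, le_rfl, Or.inr (by simpa using hRne)⟩
    · by_cases hP0 : P = 0
      · refine ⟨R.natDegree, by simp [hP0], le_rfl, Or.inr (by simpa using hRne)⟩
      · exact ⟨P.natDegree, le_rfl, hle, Or.inl (by simpa using hP0)⟩
  have hlog : Tendsto (fun i => Real.log (x i)) l atTop := Real.tendsto_log_atTop.comp hx
  have eP := (tendsto_log_mul_eval P d hdP).comp hx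
  have eR : Tendsto (fun i => R.eval (x i) / x i ^ d - R.coeff d) l (𝓝 0) := by
    have := ((tendsto_log_mul_eval R d hdR).comp hx).mul hlog.inv_tendsto_atTop
    rw [zero_mul] at this
    refine this.congr' ?_
    filter_upwards [hlog.eventually_gt_atTop 0] with i hi
    simp only [Function.comp, Pi.inv_apply]
    field_simp
  have hgd : Tendsto (fun i => (P.eval (x i) * Real.log (x i) + R.eval (x i)) / x i ^ d)
      l (𝓝 0) := by
    refine squeeze_zero_norm' ?_ (by simpa using hg.norm)
    filter_upwards [hx.eventually_ge_atTop 1] with i hi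
    rw [norm_div]
    refine div_le_self (norm_nonneg _) ?_
    rw [norm_pow, Real.norm_of_nonneg (by linarith)]
    exact one_le_pow₀ hi
  have hlin : Tendsto (fun i => P.coeff d * Real.log (x i)) l (𝓝 (-R.coeff d)) := by
    have := ((hgd.sub eP).sub eR).sub_const (R.coeff d)
    rw [sub_zero, sub_zero, zero_sub] at this
    refine this.congr fun i => ?_
    simp only [Function.comp]
    ring
  have hp : P.coeff d = 0 := by
    by_contra hp
    have := hlin.const_mul (P.coeff d)⁻¹
    refine not_tendsto_nhds_of_tendsto_atTop hlog _ (this.congr fun i => ?_)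
    field_simp
  have hr : R.coeff d = 0 := by
    simp only [hp, zero_mul] at hlin
    have := tendsto_nhds_unique hlin tendsto_const_nhds
    linarith
  exact hd.elim (fun h => h hp) (fun h => h hr)

/-- The sum `∑_{m=1}^n m^k log m`, i.e. `log Γ_k(n + 1)` at natural numbers. -/
def logGammaNat (k n : ℕ) : ℝ := ∑ m ∈ Finset.Icc 1 n, (m : ℝ) ^ k * Real.log m

open Classical in
/-- The constant `L_k`: the `n`-independent term in the behaviour of
`∑_{m=1}^n m^k log m` as `n → ∞`. -/
def L (k : ℕ) : ℝ :=
  if h : ∃ c, HasConstantTerm atTop (fun n : ℕ => (n : ℝ)) (logGammaNat k) c then h.choose else 0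

/-- The generalised Glaisher–Kinkelin–Bendersky constant `A_k`, with `log A_k = L_k`. -/
def A (k : ℕ) : ℝ := Real.exp (L k)

/-- `φ_n(x) = (B_{n+1}(x) - B_{n+1}) / (n + 1)`. -/
def phi (n : ℕ) (x : ℝ) : ℝ :=
  (Polynomial.aeval x (Polynomial.bernoulli (n + 1)) - (bernoulli (n + 1) : ℝ)) / (n + 1)

/-- The iterated integrals `I_0(x) = log Γ(x + 1)`, `I_{k+1}(x) = ∫_0^x I_k`. -/
def I : ℕ → ℝ → ℝ
  | 0, x => Real.log (Real.Gamma (x + 1))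
  | k + 1, x => ∫ t in (0 : ℝ)..x, I k t

/-- `ψ_k(x) = ∑_{r=0}^{k-1} (k choose r) L_r x^{k-r}`. -/
def psi (k : ℕ) (x : ℝ) : ℝ := ∑ r ∈ Finset.range k, (k.choose r : ℝ) * L r * x ^ (k - r)

/-- Bendersky's generalised gamma function for real argument `w > 0`, through its logarithm:
`log Γ_k(x + 1) = k! I_k(x) + H_k φ_k(x + 1) - ψ_k(x)`, with `w = x + 1`. -/
def logGamma (k : ℕ) (w : ℝ) : ℝ :=
  (k.factorial : ℝ) * I k (w - 1) + (harmonic k : ℝ) * phi k w - psi k (w - 1)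

/-- `Λ_k`, the part of `log Γ_k` that remains when its constant term `L_k` is removed. -/
def Lam (k : ℕ) (w : ℝ) : ℝ := logGamma k w - L k

end

end GKB

/-! The bridge between the two sides is the behaviour of ζ'(-k, w) as w → ∞. Euler–Maclaurin
summation of x^(-s) over unit steps writes ζ(s, w) as `-emMain` plus a series of errors. That series
is bounded uniformly for s near -k by a quantity tending to 0 as w → ∞, so Cauchy's estimate gives
ζ'(-k, w) = `stirlingMain k w` + o(1). This main term is a polynomial times log w plus a polynomial
with constant coefficient H_k B_{k+1}/(k+1).

At integers, the difference equation ζ'(-k, w+1) = ζ'(-k, w) + w^k log w telescopes from ζ'(-k) to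
the sum of m^k log m. Comparing constant terms shows that L_k exists and evaluates ζ'(-k).

For real w, `deriv_hurwitz_eq_of_difference_equation` characterises ζ'(-k, w) by its value at w = 1,
its difference equation and its asymptotic slope. That H_k B_{k+1}/(k+1) - L_k + log Γ_k(w) has
these properties is proved by induction on k: its derivative at level k+1 is k+1 times the same
expression at level k plus B_{k+1}(w)/(k+1), and `stirlingMain` obeys the same recursion up to a
multiple of 1/w. The case k = 0 rests on the convexity of log Γ. The interpolation property and the
constant term of Λ_k are then read off from the zeta side. -/

namespace GKB

/-! ### Euler–Maclaurin summation on the unit interval -/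

open Complex in
/-- Euler–Maclaurin on the unit interval, for functions `h i` each of which is the derivative of the
previous one. -/
theorem eulerMaclaurin_unitInterval {h : ℕ → ℝ → ℂ}
    (hd : ∀ i, ∀ t ∈ Set.Icc (0 : ℝ) 1, HasDerivAt (h i) (h (i + 1) t) t) (n : ℕ) :
    h 1 0 - ∑ j ∈ Finset.range (n + 2), ((bernoulli j : ℚ) : ℂ) / j.factorial * (h j 1 - h j 0) =
      (-1) ^ n / (n + 1).factorial *
        ∫ t in (0 : ℝ)..1, h (n + 2) t * (bernoulliFun (n + 1) t : ℂ) := by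
  have hu : Set.uIcc (0 : ℝ) 1 = Set.Icc 0 1 := Set.uIcc_of_le zero_le_one
  have hint (i : ℕ) : IntervalIntegrable (h i) MeasureTheory.volume 0 1 := by
    refine ContinuousOn.intervalIntegrable fun t ht => ?_
    rw [hu] at ht
    exact (hd i t ht).continuousAt.continuousWithinAt
  have hBint (m : ℕ) :
      IntervalIntegrable (fun t => (bernoulliFun m t : ℂ)) MeasureTheory.volume 0 1 :=
    (continuous_ofReal.comp (continuous_bernoulliFun m)).intervalIntegrable _ _
  have parts (i m : ℕ) : ∫ t in (0 : ℝ)..1, h i t * (bernoulliFun m t : ℂ) =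
      h i 1 * ((bernoulliFun (m + 1) 1 / (m + 1) : ℝ) : ℂ) -
        h i 0 * ((bernoulliFun (m + 1) 0 / (m + 1) : ℝ) : ℂ) -
        ∫ t in (0 : ℝ)..1, h (i + 1) t * ((bernoulliFun (m + 1) t / (m + 1) : ℝ) : ℂ) :=
    intervalIntegral.integral_mul_deriv_eq_deriv_mul
      (v := fun t => ((bernoulliFun (m + 1) t / (m + 1) : ℝ) : ℂ))
      (fun t ht => hd i t (hu ▸ ht))
      (fun t _ => (antideriv_bernoulliFun m t).ofReal_comp) (hint _) (hBint m)
  induction n with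
  | zero =>
    have h0 : ∫ t in (0 : ℝ)..1, h 1 t = h 0 1 - h 0 0 :=
      intervalIntegral.integral_eq_sub_of_hasDerivAt (fun t ht => hd 0 t (hu ▸ ht)) (hint 1)
    have h1 := parts 1 0
    simp only [bernoulliFun_zero, ofReal_one, mul_one, zero_add, bernoulliFun_one, Nat.cast_zero,
      div_one, h0] at h1
    simp only [Finset.sum_range_succ, Finset.sum_range_zero, bernoulli_zero, bernoulli_one,
      bernoulliFun_one, zero_add, pow_zero, Nat.factorial]
    push_cast at h1 ⊢
    linear_combination -h1
  | succ n ih =>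
    have h1 := parts (n + 2) (n + 1)
    rw [bernoulliFun_endpoints_eq_of_ne_one (by omega : n + 1 + 1 ≠ 1), bernoulliFun_eval_zero]
      at h1
    have h2 : ∫ t in (0 : ℝ)..1, h (n + 2 + 1) t *
        ((bernoulliFun (n + 1 + 1) t / ((n + 1 : ℕ) + 1) : ℝ) : ℂ) =
        (∫ t in (0 : ℝ)..1, h (n + 3) t * (bernoulliFun (n + 2) t : ℂ)) / (n + 2) := by
      rw [← intervalIntegral.integral_div]
      refine intervalIntegral.integral_congr fun t _ => ?_
      push_cast
      ring
    -- Each integration by parts flips the sign of the remainder, while the Bernoulli sum carries no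
    -- signs; the two agree because odd Bernoulli numbers of index at least 3 vanish.
    have h3 : (-1 : ℂ) ^ n * ((bernoulli (n + 2) : ℚ) : ℂ) = ((bernoulli (n + 2) : ℚ) : ℂ) := by
      rcases n.even_or_odd with he | ho
      · rw [he.neg_one_pow, one_mul]
      · rw [bernoulli_eq_zero_of_odd (by grind) (by omega)]
        simp
    rw [h2] at h1
    rw [Finset.sum_range_succ, ← sub_sub, ih, h1]
    have h4 : ((n + 1).factorial : ℂ) ≠ 0 := by exact_mod_cast (n + 1).factorial_ne_zero
    have h5 : ((n : ℂ) + 2) ≠ 0 := by exact_mod_cast (by omega : n + 2 ≠ 0)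
    have h6 : ((n + 1 + 1).factorial : ℂ) = (n + 2) * (n + 1).factorial := by
      rw [Nat.factorial_succ (n + 1)]
      push_cast
      ring
    have h7 : (n : ℂ) + 1 + 1 = n + 2 := by ring
    simp only [show n + 1 + 1 = n + 2 from rfl, show n + 1 + 2 = n + 3 from rfl] at *
    push_cast
    rw [h6, h7]
    field_simp
    linear_combination (h (n + 2) 1 - h (n + 2) 0) * h3

/-- The constant depends on `n` alone, which later makes the estimate uniform in both s and the base
point x. -/
theorem exists_norm_eulerMaclaurin_le (n : ℕ) : ∃ C : ℝ, 0 ≤ C ∧ ∀ (h : ℕ → ℝ → ℂ) (M : ℝ),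
    (∀ i, ∀ t ∈ Set.Icc (0 : ℝ) 1, HasDerivAt (h i) (h (i + 1) t) t) →
    (∀ t ∈ Set.Icc (0 : ℝ) 1, ‖h (n + 2) t‖ ≤ M) →
    ‖h 1 0 - ∑ j ∈ Finset.range (n + 2),
      ((bernoulli j : ℚ) : ℂ) / j.factorial * (h j 1 - h j 0)‖ ≤ C * M := by
  obtain ⟨B, hB⟩ := (isCompact_Icc (a := (0 : ℝ)) (b := 1)).exists_bound_of_continuousOn
    (continuous_bernoulliFun (n + 1)).continuousOn
  have hB0 : 0 ≤ B := (norm_nonneg _).trans (hB 0 ⟨le_rfl, zero_le_one⟩)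
  refine ⟨1 / (n + 1).factorial * B, by positivity, fun h M hd hM => ?_⟩
  have hM0 : 0 ≤ M := (norm_nonneg _).trans (hM 0 ⟨le_rfl, zero_le_one⟩)
  rw [eulerMaclaurin_unitInterval hd, norm_mul, mul_assoc]
  refine mul_le_mul (by simp) ?_ (norm_nonneg _) (by positivity)
  have := intervalIntegral.norm_integral_le_of_norm_le_const (a := (0 : ℝ)) (b := 1)
    (f := fun t => h (n + 2) t * (bernoulliFun (n + 1) t : ℂ)) (C := B * M) ?_
  · simpa using this
  · intro t ht
    rw [Set.uIoc_of_le zero_le_one] at ht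
    have ht' : t ∈ Set.Icc (0 : ℝ) 1 := ⟨ht.1.le, ht.2⟩
    rw [norm_mul, Complex.norm_real, mul_comm]
    exact mul_le_mul (hB t ht') (hM t ht') (norm_nonneg _) hB0

/-! ### Euler–Maclaurin approximation for powers x^(-s) -/

/-- The coefficient of `x ^ (1 - s - j)` in the `(j-1)`-st derivative of `x ^ (-s)`; for `j = 0`
in its antiderivative. -/
noncomputable def powCoeff : ℕ → ℂ → ℂ
  | 0, s => 1 / (1 - s)
  | j + 1, s => ∏ i ∈ Finset.range j, (-s - i)

theorem powCoeff_succ {s : ℂ} (hs : s ≠ 1) (j : ℕ) :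
    powCoeff (j + 1) s = powCoeff j s * (1 - s - j) := by
  cases j with
  | zero =>
    have : 1 - s ≠ 0 := sub_ne_zero.2 hs.symm
    simp [powCoeff, this]
  | succ j =>
    rw [powCoeff, powCoeff, Finset.prod_range_succ]
    push_cast
    ring

theorem differentiableAt_powCoeff {s : ℂ} (hs : s ≠ 1) (j : ℕ) :
    DifferentiableAt ℂ (powCoeff j) s := by
  cases j with
  | zero =>
    exact (differentiableAt_const _).div (by fun_prop) (sub_ne_zero.2 hs.symm)
  | succ j => unfold powCoeff; fun_prop

/-- The `(j-1)`-st derivative in `x` of `x ^ (-s)`. -/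
noncomputable def powDeriv (j : ℕ) (s : ℂ) (x : ℝ) : ℂ := powCoeff j s * (x : ℂ) ^ (1 - s - j)

theorem hasDerivAt_powDeriv {s : ℂ} (hs : s ≠ 1) (j : ℕ) {x : ℝ} (hx : 0 < x) :
    HasDerivAt (powDeriv j s) (powDeriv (j + 1) s x) x := by
  unfold powDeriv
  rw [powCoeff_succ hs]
  by_cases hr : 1 - s - j = 0
  · simp only [hr, mul_zero, zero_mul, Complex.cpow_zero, mul_one]
    exact hasDerivAt_const _ _
  · have := (hasDerivAt_ofReal_cpow_const hx.ne' hr).const_mul (powCoeff j s)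
    refine this.congr_deriv ?_
    rw [show 1 - s - ((j + 1 : ℕ) : ℂ) = 1 - s - j - 1 by push_cast; ring]
    ring

theorem norm_powDeriv {s : ℂ} (j : ℕ) {x : ℝ} (hx : 0 < x) :
    ‖powDeriv j s x‖ = ‖powCoeff j s‖ * x ^ (1 - s.re - j) := by
  rw [powDeriv, norm_mul, Complex.norm_cpow_eq_rpow_re_of_pos hx]
  simp

/-- The Euler–Maclaurin approximation of order `n` to the negative of the Hurwitz zeta function. -/
noncomputable def emMain (n : ℕ) (s : ℂ) (x : ℝ) : ℂ :=
  ∑ j ∈ Finset.range n, ((bernoulli j : ℚ) : ℂ) / j.factorial * powDeriv j s x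

/-- The failure of `emMain` to satisfy the difference equation of the Hurwitz zeta function. -/
noncomputable def emError (n : ℕ) (s : ℂ) (x : ℝ) : ℂ :=
  (x : ℂ) ^ (-s) - (emMain n s (x + 1) - emMain n s x)

theorem differentiableAt_powDeriv {s : ℂ} (hs : s ≠ 1) (j : ℕ) {x : ℝ} (hx : 0 < x) :
    DifferentiableAt ℂ (fun s => powDeriv j s x) s := by
  have hx' : (x : ℂ) ≠ 0 := Complex.ofReal_ne_zero.2 hx.ne'
  exact (differentiableAt_powCoeff hs j).mul
    (DifferentiableAt.const_cpow (by fun_prop) (Or.inl hx'))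

theorem differentiableAt_emMain {s : ℂ} (hs : s ≠ 1) (n : ℕ) {x : ℝ} (hx : 0 < x) :
    DifferentiableAt ℂ (fun s => emMain n s x) s :=
  DifferentiableAt.fun_sum fun j _ => (differentiableAt_powDeriv hs j hx).const_mul _

theorem differentiableAt_emError {s : ℂ} (hs : s ≠ 1) (n : ℕ) {x : ℝ} (hx : 0 < x) :
    DifferentiableAt ℂ (fun s => emError n s x) s := by
  have hx' : (x : ℂ) ≠ 0 := Complex.ofReal_ne_zero.2 hx.ne'
  exact (DifferentiableAt.const_cpow (by fun_prop) (Or.inl hx')).sub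
    ((differentiableAt_emMain hs n (by linarith)).sub (differentiableAt_emMain hs n hx))

/-- This is Euler–Maclaurin on [x, x + 1]. The lower bound on Re s makes the exponent nonpositive,
so the last derivative is largest at the left endpoint. -/
theorem exists_norm_emError_le (n : ℕ) : ∃ C : ℝ, 0 ≤ C ∧ ∀ (s : ℂ) (x : ℝ), s ≠ 1 → 0 < x →
    -(n + 1 : ℝ) ≤ s.re →
    ‖emError (n + 2) s x‖ ≤ C * (‖powCoeff (n + 2) s‖ * x ^ (-s.re - (n + 1))) := by
  obtain ⟨C, hC, H⟩ := exists_norm_eulerMaclaurin_le n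
  refine ⟨C, hC, fun s x hs hx hre => ?_⟩
  have key := H (fun j t => powDeriv j s (x + t))
    (‖powCoeff (n + 2) s‖ * x ^ (-s.re - (n + 1))) ?_ ?_
  · refine le_trans (le_of_eq ?_) key
    congr 1
    simp only [emError, emMain, ← Finset.sum_sub_distrib, ← mul_sub, add_zero]
    simp [powDeriv, powCoeff]
  · intro i t ht
    exact (hasDerivAt_powDeriv hs i (by linarith [ht.1])).comp_const_add x t
  · intro t ht
    rw [norm_powDeriv _ (by linarith [ht.1])]
    refine mul_le_mul_of_nonneg_left ?_ (norm_nonneg _)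
    have e : 1 - s.re - ((n + 2 : ℕ) : ℝ) = -s.re - (n + 1) := by push_cast; ring
    rw [e]
    exact Real.rpow_le_rpow_of_nonpos hx (by linarith [ht.1]) (by linarith)


/-! ### Uniform error bounds and continuation to s = -k -/

theorem summable_add_rpow {x a : ℝ} (hx : 0 < x) (ha : 1 < a) :
    Summable fun m : ℕ => (x + m) ^ (-a) := by
  refine ((Real.summable_one_div_nat_add_rpow x a).2 ha).congr fun m => ?_
  have : 0 < (m : ℝ) + x := by positivity
  rw [abs_of_pos this, Real.rpow_neg (by linarith), one_div, add_comm x]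

theorem tendsto_tsum_add_rpow {a : ℝ} (ha : 1 < a) :
    Tendsto (fun x : ℝ => ∑' m : ℕ, (x + m) ^ (-a)) atTop (𝓝 0) := by
  have h := tendsto_tsum_of_dominated_convergence (𝓕 := atTop)
    (f := fun (x : ℝ) (m : ℕ) => (x + m) ^ (-a)) (g := fun _ => 0)
    (bound := fun m : ℕ => ((1 : ℝ) + m) ^ (-a))
    (summable_add_rpow one_pos ha) (fun m => ?_) ?_
  · simpa using h
  · exact (tendsto_rpow_neg_atTop (by linarith)).comp (tendsto_atTop_add_const_right _ _ tendsto_id)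
  · filter_upwards [eventually_ge_atTop (1 : ℝ)] with x hx m
    rw [Real.norm_of_nonneg (by positivity)]
    exact Real.rpow_le_rpow_of_nonpos (by positivity) (by linarith) (by linarith)

/-- A convex domain that avoids `1`, meets the half-plane of convergence, and contains `-k`. -/
def domain (k : ℕ) : Set ℂ :=
  {s | -(k : ℝ) - 1 / 2 < s.re} ∩ {s | s.re - 1 < 2 * s.im} ∩ Metric.ball 0 (k + 5)

theorem isOpen_domain (k : ℕ) : IsOpen (domain k) := by
  refine ((isOpen_lt (by fun_prop) (by fun_prop)).inter
    (isOpen_lt (by fun_prop) (by fun_prop))).inter Metric.isOpen_ball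

theorem isPreconnected_domain (k : ℕ) : IsPreconnected (domain k) := by
  refine Convex.isPreconnected (((convex_halfSpace_re_gt _).inter ?_).inter (convex_ball _ _))
  have : IsLinearMap ℝ fun s : ℂ => s.re - 2 * s.im :=
    ⟨fun x y => by simp; ring, fun c x => by simp; ring⟩
  have h : {s : ℂ | s.re - 1 < 2 * s.im} = {s : ℂ | s.re - 2 * s.im < 1} := by
    ext s
    simp only [Set.mem_ofPred_eq]
    constructor <;> intro h <;> linarith
  rw [h]
  exact convex_halfSpace_lt this 1

theorem ne_one_of_mem_domain {k : ℕ} {s : ℂ} (hs : s ∈ domain k) : s ≠ 1 := by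
  rintro rfl
  have := hs.1.2
  simp at this

theorem closedBall_subset_domain (k : ℕ) : Metric.closedBall (-(k : ℂ)) (1 / 4) ⊆ domain k := by
  intro s hs
  rw [mem_closedBall_iff_norm, sub_neg_eq_add] at hs
  have h1 := abs_le.1 ((Complex.abs_re_le_norm _).trans hs)
  have h2 := abs_le.1 ((Complex.abs_im_le_norm _).trans hs)
  simp only [Complex.add_re, Complex.natCast_re, Complex.add_im, Complex.natCast_im, add_zero]
    at h1 h2
  have hk : (0 : ℝ) ≤ k := k.cast_nonneg
  refine ⟨⟨?_, ?_⟩, ?_⟩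
  · simp only [Set.mem_ofPred_eq]; linarith
  · simp only [Set.mem_ofPred_eq]; linarith
  · rw [mem_ball_zero_iff]
    calc ‖s‖ = ‖(s + k) - k‖ := by ring_nf
      _ ≤ ‖s + k‖ + ‖(k : ℂ)‖ := norm_sub_le _ _
      _ ≤ 1 / 4 + k := by rw [Complex.norm_natCast]; linarith
      _ < k + 5 := by linarith

/-- With k + 3 terms the exponent is -Re s - (k + 2), which is below -3/2 once Re s > -k - 1/2. The
polynomial `powCoeff (k + 3)` is bounded because the domain is. -/
theorem exists_norm_emError_le_on_domain (k : ℕ) : ∃ C : ℝ, 0 ≤ C ∧ ∀ s ∈ domain k, ∀ x : ℝ,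
    1 ≤ x → ‖emError (k + 3) s x‖ ≤ C * x ^ (-(3 / 2) : ℝ) := by
  obtain ⟨C, hC, H⟩ := exists_norm_emError_le (k + 1)
  obtain ⟨B, hB⟩ := (isCompact_closedBall (0 : ℂ) (k + 5)).exists_bound_of_continuousOn
    (f := powCoeff (k + 3)) (by unfold powCoeff; fun_prop)
  have hB0 : 0 ≤ B := (norm_nonneg _).trans (hB 0 (by simp; positivity))
  refine ⟨C * B, by positivity, fun s hs x hx => ?_⟩
  have hre := hs.1.1
  simp only [Set.mem_ofPred_eq] at hre
  refine (H s x (ne_one_of_mem_domain hs) (by linarith) (by push_cast; linarith)).trans ?_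
  rw [mul_assoc]
  refine mul_le_mul_of_nonneg_left ?_ hC
  refine mul_le_mul (hB s (Metric.ball_subset_closedBall hs.2)) ?_ (by positivity) hB0
  refine Real.rpow_le_rpow_of_exponent_le hx ?_
  push_cast
  linarith

theorem tendsto_powDeriv_atTop {s : ℂ} (hs : 1 < s.re) (j : ℕ) :
    Tendsto (fun x : ℝ => powDeriv j s x) atTop (𝓝 0) := by
  rw [tendsto_zero_iff_norm_tendsto_zero]
  have h1 : Tendsto (fun x : ℝ => ‖powCoeff j s‖ * x ^ (-(s.re + j - 1))) atTop
      (𝓝 (‖powCoeff j s‖ * 0)) :=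
    (tendsto_rpow_neg_atTop (by have : (0 : ℝ) ≤ j := j.cast_nonneg
                                linarith)).const_mul _
  rw [mul_zero] at h1
  refine h1.congr' ?_
  filter_upwards [eventually_gt_atTop 0] with x hx
  rw [norm_powDeriv _ hx]
  congr 2
  ring

theorem tendsto_emMain_atTop {s : ℂ} (hs : 1 < s.re) (n : ℕ) :
    Tendsto (fun x : ℝ => emMain n s x) atTop (𝓝 0) := by
  have := tendsto_finsetSum (Finset.range n) fun j _ =>
    (tendsto_powDeriv_atTop hs j).const_mul (((bernoulli j : ℚ) : ℂ) / j.factorial)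
  simpa [emMain] using this

/-- The Euler–Maclaurin formula for the Hurwitz zeta function in the half-plane of convergence. -/
theorem hurwitz_eq_of_one_lt_re {w : ℝ} (hw : 0 < w) {s : ℂ} (hs : 1 < s.re) {n : ℕ}
    (hsum : Summable fun m : ℕ => emError n s (w + m)) :
    hurwitz w s = -emMain n s w + ∑' m : ℕ, emError n s (w + m) := by
  have h1 := hsum.hasSum.tendsto_sum_nat
  have h2 := (hasSum_hurwitz hw hs).tendsto_sum_nat
  have h3 : Tendsto (fun N : ℕ => emMain n s (w + N)) atTop (𝓝 0) :=
    (tendsto_emMain_atTop hs n).comp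
      (tendsto_atTop_add_const_left _ _ tendsto_natCast_atTop_atTop)
  have h4 := (h2.sub h3).add_const (emMain n s w)
  -- By its definition `emError` is a term of the Hurwitz series minus an increment of `emMain`, so
  -- partial sums telescope.
  have h5 : ∀ N : ℕ, ∑ m ∈ Finset.range N, emError n s (w + m) =
      ∑ m ∈ Finset.range N, 1 / ((m : ℂ) + (w : ℂ)) ^ s - emMain n s (w + N) + emMain n s w := by
    intro N
    induction N with
    | zero => simp
    | succ N ih =>
      rw [Finset.sum_range_succ, ih, Finset.sum_range_succ, emError, Complex.cpow_neg]
      push_cast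
      rw [add_assoc w, add_comm (w : ℂ), one_div]
      ring
  have := tendsto_nhds_unique (h1.congr h5) h4
  rw [this]
  ring

theorem summable_emError {k : ℕ} {s : ℂ} (hs : s ∈ domain k) {w : ℝ} (hw : 1 ≤ w) :
    Summable fun m : ℕ => emError (k + 3) s (w + m) := by
  obtain ⟨C, _, H⟩ := exists_norm_emError_le_on_domain k
  refine Summable.of_norm_bounded
    ((summable_add_rpow (x := w) (a := 3 / 2) (by linarith) (by norm_num)).mul_left C) fun m => ?_
  exact H s hs _ (by have : (0 : ℝ) ≤ m := m.cast_nonneg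
                     linarith)

theorem differentiableOn_tsum_emError (k : ℕ) {w : ℝ} (hw : 1 ≤ w) :
    DifferentiableOn ℂ (fun s => ∑' m : ℕ, emError (k + 3) s (w + m)) (domain k) := by
  obtain ⟨C, _, H⟩ := exists_norm_emError_le_on_domain k
  refine Complex.differentiableOn_tsum_of_summable_norm
    ((summable_add_rpow (x := w) (a := 3 / 2) (by linarith) (by norm_num)).mul_left C)
    (fun m s hs => ?_) (isOpen_domain k) fun m s hs => ?_
  · exact (differentiableAt_emError (ne_one_of_mem_domain hs) _
      (by positivity)).differentiableWithinAt
  · exact H s hs _ (by have : (0 : ℝ) ≤ m := m.cast_nonneg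
                       linarith)

/-- Identity theorem: both sides are analytic on the connected domain and agree near 2 + i, where
the Hurwitz series converges. -/
theorem hurwitz_eqOn_domain (k : ℕ) {w : ℝ} (hw : 1 ≤ w) :
    Set.EqOn (hurwitz w)
      (fun s => -emMain (k + 3) s w + ∑' m : ℕ, emError (k + 3) s (w + m)) (domain k) := by
  have hw0 : 0 < w := by linarith
  have hmem : (2 + Complex.I : ℂ) ∈ domain k := by
    refine ⟨⟨?_, ?_⟩, ?_⟩
    · have : (0 : ℝ) ≤ k := k.cast_nonneg
      simp; linarith
    · simp
    · rw [mem_ball_zero_iff]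
      have : (0 : ℝ) ≤ k := k.cast_nonneg
      refine (norm_add_le _ _).trans_lt ?_
      simp; linarith
  refine AnalyticOnNhd.eqOn_of_preconnected_of_eventuallyEq (𝕜 := ℂ) (z₀ := 2 + Complex.I)
    ?_ ?_ (isPreconnected_domain k) hmem ?_
  · refine DifferentiableOn.analyticOnNhd (fun s hs => ?_) (isOpen_domain k)
    exact (differentiableAt_hurwitz (ne_one_of_mem_domain hs)).differentiableWithinAt
  · refine DifferentiableOn.analyticOnNhd
      (DifferentiableOn.add (fun s hs => ?_) (differentiableOn_tsum_emError k hw))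
      (isOpen_domain k)
    exact (differentiableAt_emMain (ne_one_of_mem_domain hs) _ hw0).neg.differentiableWithinAt
  · have h1 : ∀ᶠ s : ℂ in 𝓝 (2 + Complex.I), 1 < s.re :=
      (isOpen_lt continuous_const Complex.continuous_re).mem_nhds (by simp)
    filter_upwards [h1, (isOpen_domain k).mem_nhds hmem] with s hs hsd
    exact hurwitz_eq_of_one_lt_re hw0 hs (summable_emError hsd hw)

theorem neg_natCast_mem_domain (k : ℕ) : (-(k : ℂ)) ∈ domain k :=
  closedBall_subset_domain k (Metric.mem_closedBall_self (by norm_num))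

/-- As `w → ∞`, the derivative of the Hurwitz zeta function at `-k` is that of its
Euler–Maclaurin approximation, up to `o(1)`. -/
theorem tendsto_deriv_hurwitz_add_deriv_emMain (k : ℕ) :
    Tendsto (fun w : ℝ => deriv (hurwitz w) (-(k : ℂ)) +
      deriv (fun s => emMain (k + 3) s w) (-(k : ℂ))) atTop (𝓝 0) := by
  obtain ⟨C, hC, H⟩ := exists_norm_emError_le_on_domain k
  have hlim : Tendsto (fun x : ℝ => C * (∑' m : ℕ, (x + m) ^ (-(3 / 2) : ℝ)) / (1 / 4))
      atTop (𝓝 (C * 0 / (1 / 4))) :=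
    ((tendsto_tsum_add_rpow (by norm_num)).const_mul C).div_const _
  rw [mul_zero, zero_div] at hlim
  refine squeeze_zero_norm' ?_ hlim
  filter_upwards [eventually_ge_atTop (1 : ℝ)] with w hw
  have hk := neg_natCast_mem_domain k
  have hd := (differentiableOn_tsum_emError k hw)
  have hdk := (hd _ hk).differentiableAt ((isOpen_domain k).mem_nhds hk)
  have h1 : deriv (hurwitz w) (-(k : ℂ)) = -deriv (fun s => emMain (k + 3) s w) (-(k : ℂ)) +
      deriv (fun s => ∑' m : ℕ, emError (k + 3) s (w + m)) (-(k : ℂ)) := by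
    rw [((hurwitz_eqOn_domain k hw).eventuallyEq_of_mem
      ((isOpen_domain k).mem_nhds hk)).deriv_eq]
    exact ((differentiableAt_emMain (ne_one_of_mem_domain hk) _
      (by linarith)).hasDerivAt.neg.add hdk.hasDerivAt).deriv
  rw [h1, neg_add_cancel_comm]
  -- Cauchy's estimate on the circle of radius 1/4 about -k turns the bound on the error series into
  -- a bound on its s-derivative.
  refine Complex.norm_deriv_le_of_forall_mem_sphere_norm_le (by norm_num) ?_ fun s hs => ?_
  · refine DifferentiableOn.diffContOnCl (hd.mono ?_)
    rw [closure_ball _ (by norm_num)]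
    exact closedBall_subset_domain k
  · have hs' := closedBall_subset_domain k (Metric.sphere_subset_closedBall hs)
    rw [← tsum_mul_left]
    refine tsum_of_norm_bounded
      ((summable_add_rpow (x := w) (a := 3 / 2) (by linarith) (by norm_num)).mul_left C).hasSum
      fun m => ?_
    exact H s hs' _ (by have : (0 : ℝ) ≤ m := m.cast_nonneg
                        linarith)


/-! ### The explicit expansion at s = -k -/

/-- The factors of the product at -k are k, k - 1, …, k - j + 1, nonzero since j ≤ k, so the
logarithmic derivative is minus the sum of their reciprocals, H_k - H_{k-j}. -/
theorem hasDerivAt_powCoeff_succ (k : ℕ) {j : ℕ} (hj : j ≤ k) :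
    powCoeff (j + 1) (-(k : ℂ)) = k.descFactorial j ∧
    HasDerivAt (powCoeff (j + 1))
      (-((k.descFactorial j : ℂ) * ((harmonic k : ℂ) - (harmonic (k - j) : ℂ)))) (-(k : ℂ)) := by
  induction j with
  | zero =>
    refine ⟨by simp [powCoeff], ?_⟩
    have : powCoeff (0 + 1) = fun _ => 1 := by ext; simp [powCoeff]
    rw [this]
    simpa using hasDerivAt_const (-(k : ℂ)) (1 : ℂ)
  | succ j ih =>
    obtain ⟨h1, h2⟩ := ih (by omega)
    have h3 : powCoeff (j + 1 + 1) = fun s => powCoeff (j + 1) s * (-s - j) := by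
      ext s
      rw [powCoeff, powCoeff, Finset.prod_range_succ]
    obtain ⟨m, rfl⟩ : ∃ m, k = j + 1 + m := ⟨k - (j + 1), by omega⟩
    have e1 : j + 1 + m - j = m + 1 := by omega
    have e2 : j + 1 + m - (j + 1) = m := by omega
    rw [e1] at h2
    rw [h3, e2, Nat.descFactorial_succ, e1]
    refine ⟨by simp only [h1]; push_cast; ring, ?_⟩
    have h4 := h2.fun_mul (((hasDerivAt_id (-((j + 1 + m : ℕ) : ℂ))).neg).sub_const (j : ℂ))
    simp only [id, Pi.neg_apply, h1] at h4
    refine h4.congr_deriv ?_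
    have : (m : ℂ) + 1 ≠ 0 := by exact_mod_cast m.succ_ne_zero
    rw [harmonic_succ]
    push_cast
    field_simp
    ring

theorem hasDerivAt_powDeriv_of_powCoeff {j : ℕ} {s d : ℂ} (hd : HasDerivAt (powCoeff j) d s)
    {x : ℝ} (hx : 0 < x) : HasDerivAt (fun s => powDeriv j s x)
      ((x : ℂ) ^ (1 - s - j) * (d - powCoeff j s * (Real.log x : ℂ))) s := by
  have hx' : (x : ℂ) ≠ 0 := Complex.ofReal_ne_zero.2 hx.ne'
  have h1 : HasDerivAt (fun s : ℂ => 1 - s - j) (-1) s :=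
    ((hasDerivAt_id s).const_sub 1).sub_const _
  refine (hd.mul (h1.const_cpow (Or.inl hx'))).congr_deriv ?_
  rw [Complex.ofReal_log hx.le]
  ring

/-- Writing the coefficient as a falling factorial of k + 1 divided by k + 1 covers the
antiderivative j = 0 as well: there H_k - H_{k+1} = -1/(k + 1) accounts for the derivative of 1/(1 -
s). -/
theorem hasDerivAt_powDeriv_neg_nat (k : ℕ) {j : ℕ} (hj : j ≤ k + 1) {x : ℝ} (hx : 0 < x) :
    HasDerivAt (fun s => powDeriv j s x)
      (-(((k + 1).descFactorial j / (k + 1) * (x ^ (k + 1 - j) *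
        (Real.log x + (harmonic k - harmonic (k + 1 - j)))) : ℝ) : ℂ)) (-(k : ℂ)) := by
  have hk : (k : ℂ) + 1 ≠ 0 := by exact_mod_cast k.succ_ne_zero
  have hexp : (x : ℂ) ^ (1 - -(k : ℂ) - j) = (x : ℂ) ^ (k + 1 - j) := by
    rw [← Complex.cpow_natCast, Nat.cast_sub hj]
    congr 1
    push_cast
    ring
  cases j with
  | zero =>
    have h1 : HasDerivAt (powCoeff 0) (1 / (k + 1) ^ 2) (-(k : ℂ)) := by
      have h2 : HasDerivAt (fun s : ℂ => 1 - s) (-1) (-(k : ℂ)) := (hasDerivAt_id _).const_sub 1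
      have h3 := h2.fun_inv (by rw [sub_neg_eq_add, add_comm]; exact hk)
      have h4 : powCoeff 0 = fun s => (1 - s)⁻¹ := by ext s; simp [powCoeff]
      rw [h4]
      refine h3.congr_deriv ?_
      rw [sub_neg_eq_add, add_comm, neg_neg]
    refine (hasDerivAt_powDeriv_of_powCoeff h1 hx).congr_deriv ?_
    rw [hexp, powCoeff, tsub_zero, Nat.descFactorial_zero, harmonic_succ]
    push_cast
    rw [sub_neg_eq_add, add_comm 1 (k : ℂ)]
    field_simp
    ring
  | succ j =>
    obtain ⟨h1, h2⟩ := hasDerivAt_powCoeff_succ k (j := j) (by omega)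
    refine (hasDerivAt_powDeriv_of_powCoeff h2 hx).congr_deriv ?_
    rw [hexp, h1, Nat.succ_descFactorial_succ, Nat.add_sub_add_right]
    push_cast
    field_simp
    ring

/-- The `o(1)`-truncated asymptotic expansion of `ζ'(-k, x)` as `x → ∞`. -/
noncomputable def stirlingMain (k : ℕ) (x : ℝ) : ℝ :=
  ∑ j ∈ Finset.range (k + 2), (bernoulli j : ℝ) * (k + 1).choose j / (k + 1) *
    (x ^ (k + 1 - j) * (Real.log x + (harmonic k - harmonic (k + 1 - j))))

theorem hasDerivAt_emMain_neg_nat (k : ℕ) {x : ℝ} (hx : 0 < x) :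
    HasDerivAt (fun s => emMain (k + 2) s x) (-(stirlingMain k x : ℂ)) (-(k : ℂ)) := by
  have h := HasDerivAt.fun_sum (u := Finset.range (k + 2)) fun j hj =>
    (hasDerivAt_powDeriv_neg_nat k (Nat.lt_succ_iff.1 (Finset.mem_range.1 hj)) hx).const_mul
      (((bernoulli j : ℚ) : ℂ) / j.factorial)
  refine h.congr_deriv ?_
  rw [stirlingMain, Complex.ofReal_sum, ← Finset.sum_neg_distrib]
  refine Finset.sum_congr rfl fun j _ => ?_
  have h1 : (j.factorial : ℂ) ≠ 0 := by exact_mod_cast j.factorial_ne_zero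
  rw [Nat.descFactorial_eq_factorial_mul_choose]
  push_cast
  field_simp

/-- The error bound needs one term more than the expansion retains. That term is negligible: its
coefficient vanishes at -k, so no logarithm survives and its derivative is a multiple of 1/x. -/
theorem tendsto_deriv_powDeriv_neg_nat (k : ℕ) :
    Tendsto (fun x : ℝ => deriv (fun s => powDeriv (k + 2) s x) (-(k : ℂ))) atTop (𝓝 0) := by
  have h1 := hasDerivAt_powCoeff_succ k le_rfl
  have h3 : powCoeff (k + 1 + 1) = fun s => powCoeff (k + 1) s * (-s - k) := by
    ext s
    rw [powCoeff, powCoeff, Finset.prod_range_succ]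
  have h0 : powCoeff (k + 1 + 1) (-(k : ℂ)) = 0 := by simp [h3]
  set d := deriv (powCoeff (k + 1 + 1)) (-(k : ℂ)) with hd
  have h5 : Tendsto (fun x : ℝ => ((x⁻¹ : ℝ) : ℂ) * d) atTop (𝓝 (((0 : ℝ) : ℂ) * d)) :=
    ((Complex.continuous_ofReal.tendsto _).comp tendsto_inv_atTop_zero).mul_const d
  rw [Complex.ofReal_zero, zero_mul] at h5
  refine h5.congr' ?_
  filter_upwards [eventually_gt_atTop 0] with x hx
  have h4 : HasDerivAt (powCoeff (k + 1 + 1)) d (-(k : ℂ)) :=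
    (differentiableAt_powCoeff (ne_one_of_mem_domain (neg_natCast_mem_domain k)) _).hasDerivAt
  rw [(hasDerivAt_powDeriv_of_powCoeff h4 hx).deriv, h0]
  have e : (1 : ℂ) - -(k : ℂ) - ((k + 1 + 1 : ℕ) : ℂ) = -1 := by push_cast; ring
  rw [e, Complex.cpow_neg_one]
  simp

theorem tendsto_deriv_hurwitz_sub_stirlingMain (k : ℕ) :
    Tendsto (fun w : ℝ => deriv (hurwitz w) (-(k : ℂ)) - (stirlingMain k w : ℂ))
      atTop (𝓝 0) := by
  have h := (tendsto_deriv_hurwitz_add_deriv_emMain k).sub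
    ((tendsto_deriv_powDeriv_neg_nat k).const_mul
      (((bernoulli (k + 2) : ℚ) : ℂ) / (k + 2).factorial))
  rw [mul_zero, sub_zero] at h
  refine h.congr' ?_
  filter_upwards [eventually_gt_atTop 0] with w hw
  have h1 : (fun s => emMain (k + 3) s w) = fun s => emMain (k + 2) s w +
      ((bernoulli (k + 2) : ℚ) : ℂ) / (k + 2).factorial * powDeriv (k + 2) s w := by
    ext s
    rw [emMain, Finset.sum_range_succ, ← emMain]
  have hd := differentiableAt_powDeriv
    (ne_one_of_mem_domain (neg_natCast_mem_domain k)) (k + 2) hw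
  rw [h1, ((hasDerivAt_emMain_neg_nat k hw).fun_add (hd.hasDerivAt.const_mul _)).deriv]
  ring

theorem bernoulliFun_eq_sum (n : ℕ) (x : ℝ) : bernoulliFun n x =
    ∑ j ∈ Finset.range (n + 1), (bernoulli j : ℝ) * n.choose j * x ^ (n - j) := by
  rw [bernoulliFun, Polynomial.bernoulli, Polynomial.map_sum, Polynomial.eval_finsetSum]
  refine Finset.sum_congr rfl fun j _ => ?_
  simp

theorem hasDerivAt_pow_mul_log_add (m : ℕ) (c : ℝ) {x : ℝ} (hx : 0 < x) :
    HasDerivAt (fun x : ℝ => x ^ (m + 1) * (Real.log x + (c - harmonic (m + 1))))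
      ((m + 1) * (x ^ m * (Real.log x + (c - harmonic m)))) x := by
  have h := (hasDerivAt_pow (m + 1) x).fun_mul
    ((Real.hasDerivAt_log hx.ne').add_const (c - harmonic (m + 1)))
  refine h.congr_deriv ?_
  have hm : (m : ℝ) + 1 ≠ 0 := by positivity
  rw [harmonic_succ, Nat.add_sub_cancel]
  push_cast
  field_simp
  ring

theorem hasDerivAt_stirlingMain (k : ℕ) {x : ℝ} (hx : 0 < x) :
    HasDerivAt (stirlingMain k)
      (∑ j ∈ Finset.range (k + 1), (bernoulli j : ℝ) * k.choose j *
        (x ^ (k - j) * (Real.log x + (harmonic k - harmonic (k - j)))) +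
        bernoulli (k + 1) / (k + 1) * x⁻¹) x := by
  have hk : (k : ℝ) + 1 ≠ 0 := by positivity
  have h1 : HasDerivAt (fun x => ∑ j ∈ Finset.range (k + 1), (bernoulli j : ℝ) * (k + 1).choose j /
      (k + 1) * (x ^ (k + 1 - j) * (Real.log x + (harmonic k - harmonic (k + 1 - j)))))
      (∑ j ∈ Finset.range (k + 1), (bernoulli j : ℝ) * k.choose j *
        (x ^ (k - j) * (Real.log x + (harmonic k - harmonic (k - j))))) x := by
    refine HasDerivAt.fun_sum fun j hj => ?_
    have hj' := Finset.mem_range.1 hj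
    have e : k + 1 - j = k - j + 1 := by omega
    have h2 := (hasDerivAt_pow_mul_log_add (k - j) (harmonic k) hx).const_mul
      ((bernoulli j : ℝ) * (k + 1).choose j / (k + 1))
    rw [e]
    refine h2.congr_deriv ?_
    have h3 := Nat.choose_mul_succ_eq k j
    rw [e] at h3
    have h4 : (k.choose j : ℝ) * (k + 1) = (k + 1).choose j * ((k - j : ℕ) + 1) := by
      exact_mod_cast h3
    rw [← mul_assoc]
    congr 1
    field_simp
    linear_combination -(bernoulli j : ℝ) * h4
  -- The term j = k + 1 has exponent 0 and is split off; it alone produces the 1/x in the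
  -- derivative.
  have h2 : stirlingMain k = fun x => ∑ j ∈ Finset.range (k + 1), (bernoulli j : ℝ) *
      (k + 1).choose j / (k + 1) * (x ^ (k + 1 - j) *
        (Real.log x + (harmonic k - harmonic (k + 1 - j)))) +
      bernoulli (k + 1) / (k + 1) * (Real.log x + harmonic k) := by
    ext x
    rw [stirlingMain, Finset.sum_range_succ]
    simp
  rw [h2]
  exact h1.fun_add (((Real.hasDerivAt_log hx.ne').add_const _).const_mul _)

theorem hasDerivAt_stirlingMain_zero {x : ℝ} (hx : 0 < x) :
    HasDerivAt (stirlingMain 0) (Real.log x - 1 / 2 * x⁻¹) x := by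
  refine (hasDerivAt_stirlingMain 0 hx).congr_deriv ?_
  simp [bernoulli_one]
  ring

/-- Splitting H_{k+1} = H_k + 1/(k + 1) separates (k + 1) `stirlingMain k` from a Bernoulli
polynomial, matching `hasDerivAt_logGamma_succ`. -/
theorem hasDerivAt_stirlingMain_succ (k : ℕ) {x : ℝ} (hx : 0 < x) :
    HasDerivAt (stirlingMain (k + 1)) ((k + 1) * stirlingMain k x +
      bernoulliFun (k + 1) x / (k + 1) + bernoulli (k + 2) / (k + 2) * x⁻¹) x := by
  refine (hasDerivAt_stirlingMain (k + 1) hx).congr_deriv ?_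
  have hk : (k : ℝ) + 1 ≠ 0 := by positivity
  congr 1
  · rw [stirlingMain, bernoulliFun_eq_sum, Finset.mul_sum, Finset.sum_div,
      ← Finset.sum_add_distrib]
    refine Finset.sum_congr rfl fun j _ => ?_
    rw [harmonic_succ]
    push_cast
    field_simp
    ring
  · push_cast
    ring

theorem stirlingMain_eq_eval (k : ℕ) : ∃ P Q : Polynomial ℝ,
    Q.coeff 0 = harmonic k * bernoulli (k + 1) / (k + 1) ∧
    ∀ x, stirlingMain k x = P.eval x * Real.log x + Q.eval x := by
  refine ⟨∑ j ∈ Finset.range (k + 2), Polynomial.C ((bernoulli j : ℝ) * (k + 1).choose j / (k + 1)) *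
      Polynomial.X ^ (k + 1 - j),
    ∑ j ∈ Finset.range (k + 2), Polynomial.C ((bernoulli j : ℝ) * (k + 1).choose j / (k + 1) *
      (harmonic k - harmonic (k + 1 - j))) * Polynomial.X ^ (k + 1 - j), ?_, fun x => ?_⟩
  · rw [Polynomial.coeff_zero_eq_eval_zero, Polynomial.eval_finsetSum, Finset.sum_range_succ,
      Finset.sum_eq_zero]
    · simp
      ring
    · intro j hj
      have : k + 1 - j ≠ 0 := by have := Finset.mem_range.1 hj; omega
      simp [this]
  · rw [stirlingMain, Polynomial.eval_finsetSum, Polynomial.eval_finsetSum, Finset.sum_mul,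
      ← Finset.sum_add_distrib]
    refine Finset.sum_congr rfl fun j _ => ?_
    simp only [Polynomial.eval_mul, Polynomial.eval_C, Polynomial.eval_pow, Polynomial.eval_X]
    ring


/-! ### Difference equations, existence of L_k and the value of ζ'(-k) -/

theorem hurwitz_add_one {w : ℝ} (hw : 0 < w) (s : ℂ) :
    hurwitz (w + 1) s = hurwitz w s - 1 / (w : ℂ) ^ s := by
  obtain ⟨m, hm⟩ : ∃ m : ℕ, ⌈w⌉₊ = m + 1 :=
    ⟨⌈w⌉₊ - 1, by have := Nat.ceil_pos.2 hw; omega⟩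
  have hcirc : ((w + 1 : ℝ) : UnitAddCircle) = (w : UnitAddCircle) := by
    rw [AddCircle.coe_add, AddCircle.coe_period, add_zero]
  have hceil : ⌈w + 1⌉₊ = m + 1 + 1 := by rw [Nat.ceil_add_one hw.le, hm]
  rw [hurwitz, hurwitz, hcirc, hceil, hm, Nat.add_sub_cancel, Nat.add_sub_cancel,
    Finset.sum_range_succ', sub_sub]
  congr 2
  · refine Finset.sum_congr rfl fun j _ => ?_
    congr 3
    push_cast
    ring
  · simp

theorem hurwitz_one : hurwitz 1 = riemannZeta := by
  ext s
  have : ((1 : ℝ) : UnitAddCircle) = 0 := AddCircle.coe_period 1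
  rw [hurwitz, this, HurwitzZeta.hurwitzZeta_zero]
  simp

theorem neg_natCast_ne_one (k : ℕ) : (-(k : ℂ)) ≠ 1 :=
  ne_one_of_mem_domain (neg_natCast_mem_domain k)

theorem deriv_hurwitz_add_one (k : ℕ) {w : ℝ} (hw : 0 < w) :
    deriv (hurwitz (w + 1)) (-(k : ℂ)) =
      deriv (hurwitz w) (-(k : ℂ)) + ((w ^ k * Real.log w : ℝ) : ℂ) := by
  have hw' : (w : ℂ) ≠ 0 := Complex.ofReal_ne_zero.2 hw.ne'
  have h1 : hurwitz (w + 1) = fun s => hurwitz w s - (w : ℂ) ^ (-s) := by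
    ext s
    rw [hurwitz_add_one hw, Complex.cpow_neg, one_div]
  have h2 := (hasDerivAt_neg (-(k : ℂ))).const_cpow (c := (w : ℂ)) (Or.inl hw')
  have h3 := (differentiableAt_hurwitz (w := w) (neg_natCast_ne_one k)).hasDerivAt.fun_sub h2
  rw [h1, h3.deriv, neg_neg, Complex.cpow_natCast, ← Complex.ofReal_log hw.le]
  push_cast
  ring

theorem logGammaNat_succ (k n : ℕ) : logGammaNat k (n + 1) =
    logGammaNat k n + ((n : ℝ) + 1) ^ k * Real.log (n + 1) := by
  rw [logGammaNat, Finset.sum_Icc_succ_top (by omega), ← logGammaNat]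
  push_cast
  rfl

theorem deriv_hurwitz_natCast_add_one (k n : ℕ) :
    deriv (hurwitz (n + 1)) (-(k : ℂ)) =
      deriv riemannZeta (-(k : ℂ)) + (logGammaNat k n : ℂ) := by
  induction n with
  | zero => simp [hurwitz_one, logGammaNat]
  | succ n ih =>
    push_cast
    rw [deriv_hurwitz_add_one k (by positivity), ih, logGammaNat_succ]
    push_cast
    ring

theorem HasConstantTerm.of_tendsto {ι : Type} {l : Filter ι} {x f : ι → ℝ} {c : ℝ}
    (P Q : Polynomial ℝ)
    (h : Tendsto (fun i => f i - (P.eval (x i) * Real.log (x i) + Q.eval (x i))) l (𝓝 c)) :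
    HasConstantTerm l x f (c + Q.coeff 0) := by
  refine ⟨P, Q - Polynomial.C (Q.coeff 0), by simp, (h.add_const (Q.coeff 0)).congr fun i => ?_⟩
  simp only [Polynomial.eval_sub, Polynomial.eval_C]
  ring

/-- A function that is `stirlingMain k x + x ^ k * log x` up to `c + o(1)` has a constant term. -/
theorem hasConstantTerm_of_tendsto_sub_stirlingMain {ι : Type} {l : Filter ι} {x f : ι → ℝ}
    (k : ℕ) {c : ℝ}
    (h : Tendsto (fun i => f i - x i ^ k * Real.log (x i) - stirlingMain k (x i)) l (𝓝 c)) :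
    HasConstantTerm l x f (c + harmonic k * bernoulli (k + 1) / (k + 1)) := by
  obtain ⟨P, Q, hQ, hPQ⟩ := stirlingMain_eq_eval k
  rw [← hQ]
  refine HasConstantTerm.of_tendsto (P + Polynomial.X ^ k) Q (h.congr fun i => ?_)
  rw [hPQ]
  simp only [Polynomial.eval_add, Polynomial.eval_pow, Polynomial.eval_X]
  ring

/-- Two expressions for ζ'(-k, n + 1) are equated: the telescoped one, and a single step from ζ'(-k,
n), whose asymptotics are known. -/
theorem tendsto_logGammaNat_sub_stirlingMain (k : ℕ) :
    Tendsto (fun n : ℕ =>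
      ((logGammaNat k n - (n : ℝ) ^ k * Real.log n - stirlingMain k n : ℝ) : ℂ))
      atTop (𝓝 (-deriv riemannZeta (-(k : ℂ)))) := by
  have h := ((tendsto_deriv_hurwitz_sub_stirlingMain k).comp
    tendsto_natCast_atTop_atTop).sub_const (deriv riemannZeta (-(k : ℂ)))
  rw [zero_sub] at h
  refine h.congr' ?_
  filter_upwards [eventually_gt_atTop 0] with n hn
  have hn' : (0 : ℝ) < n := by exact_mod_cast hn
  have h1 := deriv_hurwitz_add_one k hn'
  rw [deriv_hurwitz_natCast_add_one] at h1
  simp only [Function.comp]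
  push_cast at h1 ⊢
  linear_combination -h1

/-- ζ'(-k) is real because its negative is a limit of real numbers. -/
theorem deriv_riemannZeta_neg_nat_eq_re (k : ℕ) :
    deriv riemannZeta (-(k : ℂ)) = ((deriv riemannZeta (-(k : ℂ))).re : ℂ) ∧
    Tendsto (fun n : ℕ => logGammaNat k n - (n : ℝ) ^ k * Real.log n - stirlingMain k n)
      atTop (𝓝 (-(deriv riemannZeta (-(k : ℂ))).re)) := by
  have h := tendsto_logGammaNat_sub_stirlingMain k
  have hre := (Complex.continuous_re.tendsto _).comp h
  simp only [Complex.neg_re, Function.comp_def, Complex.ofReal_re] at hre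
  refine ⟨?_, hre⟩
  have h2 := tendsto_nhds_unique h ((Complex.continuous_ofReal.tendsto _).comp hre)
  rw [Complex.ofReal_neg] at h2
  exact neg_injective h2

theorem hasConstantTerm_logGammaNat (k : ℕ) :
    HasConstantTerm atTop (fun n : ℕ => (n : ℝ)) (logGammaNat k) (L k) := by
  have h : ∃ c, HasConstantTerm atTop (fun n : ℕ => (n : ℝ)) (logGammaNat k) c :=
    ⟨_, hasConstantTerm_of_tendsto_sub_stirlingMain k (deriv_riemannZeta_neg_nat_eq_re k).2⟩
  rw [L, dif_pos h]
  exact h.choose_spec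

theorem deriv_riemannZeta_neg_nat (k : ℕ) : deriv riemannZeta (-(k : ℂ)) =
    ((harmonic k * bernoulli (k + 1) / (k + 1) - L k : ℝ) : ℂ) := by
  obtain ⟨h1, h2⟩ := deriv_riemannZeta_neg_nat_eq_re k
  have h3 := (hasConstantTerm_logGammaNat k).unique tendsto_natCast_atTop_atTop
    (hasConstantTerm_of_tendsto_sub_stirlingMain k h2)
  rw [h1]
  congr 1
  linarith

/-! ### Characterisation of ζ'(-k, w) by its difference equation -/

theorem tendsto_sub_of_tendsto_deriv_zero {f f' : ℝ → ℝ}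
    (hf : ∀ᶠ x in atTop, HasDerivAt f (f' x) x) (hf' : Tendsto f' atTop (𝓝 0)) {h : ℝ}
    (hh : 0 ≤ h) : Tendsto (fun x => f (x + h) - f x) atTop (𝓝 0) := by
  rw [Metric.tendsto_atTop]
  intro ε hε
  have hδ : 0 < ε / (h + 1) := by positivity
  have h1 : ∀ᶠ x in atTop, HasDerivAt f (f' x) x ∧ ‖f' x‖ ≤ ε / (h + 1) := by
    refine hf.and ?_
    filter_upwards [hf'.norm.eventually_lt_const (by simpa using hδ)] with x hx using hx.le
  obtain ⟨N, hN⟩ := eventually_atTop.1 h1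
  refine ⟨N, fun x hx => ?_⟩
  have h2 := (convex_Ici N).norm_image_sub_le_of_norm_hasDerivWithin_le
    (fun y hy => (hN y hy).1.hasDerivWithinAt) (fun y hy => (hN y hy).2)
    (Set.mem_Ici.2 hx) (Set.mem_Ici.2 (by linarith : N ≤ x + h))
  rw [dist_zero_right]
  refine h2.trans_lt ?_
  rw [add_sub_cancel_left, Real.norm_of_nonneg hh, div_mul_eq_mul_div, div_lt_iff₀ (by positivity)]
  nlinarith

/-- A function which agrees with `ζ'(-k, w)` at `w = 1`, satisfies its difference equation up to a
constant, and whose derivative is asymptotically right, is equal to `ζ'(-k, w)`. -/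
theorem deriv_hurwitz_eq_of_difference_equation (k : ℕ) {g g' E' : ℝ → ℝ} {C : ℝ}
    (h1 : deriv riemannZeta (-(k : ℂ)) = g 1)
    (hg : ∀ w, 0 < w → HasDerivAt g (g' w) w)
    (hE : ∀ w, 0 < w → HasDerivAt (stirlingMain k) (E' w) w)
    (hgE : Tendsto (fun w => g' w - E' w) atTop (𝓝 0))
    (hdiff : ∀ w, 0 < w → g (w + 1) - g w = w ^ k * Real.log w + C) {w : ℝ} (hw : 0 < w) :
    deriv (hurwitz w) (-(k : ℂ)) = g w := by
  set p : ℝ → ℂ := fun w => deriv (hurwitz w) (-(k : ℂ)) - g w with hp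
  have hp1 (w : ℝ) (hw : 0 < w) : p (w + 1) = p w - C := by
    have h2 := hdiff w hw
    have h3 : (g (w + 1) : ℂ) = g w + (w ^ k * Real.log w : ℝ) + C := by
      rw [← Complex.ofReal_add, ← Complex.ofReal_add]
      congr 1
      linarith
    simp only [hp, deriv_hurwitz_add_one k hw, h3]
    ring
  -- `stirlingMain` is the intermediary: ζ'(-k, ·) differs from it by o(1), and `g` differs from it
  -- by a function with derivative tending to 0. No w-derivative of ζ'(-k, w) is needed.
  have hlim (h : ℝ) (hh : 0 ≤ h) : Tendsto (fun w => p (w + h) - p w) atTop (𝓝 0) := by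
    have a1 := tendsto_deriv_hurwitz_sub_stirlingMain k
    have a2 := a1.comp (tendsto_atTop_add_const_right _ h tendsto_id)
    have a3 := tendsto_sub_of_tendsto_deriv_zero (f := fun w => g w - stirlingMain k w)
      (by filter_upwards [eventually_gt_atTop 0] with w hw using (hg w hw).fun_sub (hE w hw))
      hgE hh
    have a4 := (a2.sub a1).sub ((Complex.continuous_ofReal.tendsto _).comp a3)
    rw [Complex.ofReal_zero, sub_zero, sub_zero] at a4
    refine a4.congr fun w => ?_
    simp only [Function.comp, id, hp]
    push_cast
    ring
  have hC : (C : ℂ) = 0 := by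
    have h2 : Tendsto (fun w => p (w + 1) - p w) atTop (𝓝 (-(C : ℂ))) := by
      refine tendsto_const_nhds.congr' ?_
      filter_upwards [eventually_gt_atTop 0] with w hw
      rw [hp1 w hw]
      ring
    exact neg_eq_zero.1 (tendsto_nhds_unique h2 (hlim 1 zero_le_one))
  have hp2 (w : ℝ) (hw : 0 < w) (n : ℕ) : p (w + n) = p w := by
    induction n with
    | zero => simp
    | succ n ih =>
      push_cast
      rw [← add_assoc, hp1 _ (by positivity), ih, hC, sub_zero]
  have hp0 : p 1 = 0 := by simp [hp, hurwitz_one, h1]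
  -- Since p has period 1, p(w) = p(w + n) - p(1 + n) for every n, and this tends to 0.
  have hp3 (w : ℝ) (hw : 1 ≤ w) : p w = 0 := by
    have h2 := (hlim (w - 1) (by linarith)).comp
      (tendsto_atTop_add_const_left _ (1 : ℝ) (tendsto_natCast_atTop_atTop (R := ℝ)))
    have h3 : Tendsto (fun _ : ℕ => p w) atTop (𝓝 0) := by
      refine h2.congr fun n => ?_
      simp only [Function.comp]
      rw [hp2 1 one_pos, hp0, sub_zero, show 1 + (n : ℝ) + (w - 1) = w + n by ring,
        hp2 w (by linarith)]
    exact tendsto_nhds_unique tendsto_const_nhds h3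
  have h4 := hp3 (w + 1) (by linarith)
  rw [hp1 w hw, hC, sub_zero] at h4
  exact sub_eq_zero.1 h4


/-! ### Calculus of Bendersky's function -/

theorem hasDerivAt_I_zero {x : ℝ} (hx : -1 < x) :
    HasDerivAt (I 0) (deriv (Real.log ∘ Real.Gamma) (x + 1)) x := by
  have h1 : DifferentiableAt ℝ (Real.log ∘ Real.Gamma) (x + 1) :=
    (Real.differentiableAt_Gamma fun m => by
      have : (0 : ℝ) ≤ m := m.cast_nonneg
      linarith).log (Real.Gamma_pos_of_pos (by linarith)).ne'
  exact h1.hasDerivAt.comp_add_const x 1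

theorem hasDerivAt_I_succ_of_continuousOn {k : ℕ} (hc : ContinuousOn (I k) (Set.Ioi (-1))) {x : ℝ}
    (hx : -1 < x) : HasDerivAt (I (k + 1)) (I k x) x := by
  have hsub : Set.uIcc 0 x ⊆ Set.Ioi (-1) := fun y hy =>
    lt_of_lt_of_le (lt_min (by norm_num) hx) hy.1
  exact intervalIntegral.integral_hasDerivAt_right (hc.mono hsub).intervalIntegrable
    (hc.stronglyMeasurableAtFilter isOpen_Ioi x hx) (hc.continuousAt (Ioi_mem_nhds hx))

theorem continuousOn_I (k : ℕ) : ContinuousOn (I k) (Set.Ioi (-1)) := by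
  induction k with
  | zero => exact fun x hx => (hasDerivAt_I_zero hx).continuousAt.continuousWithinAt
  | succ k ih =>
    exact fun x hx => (hasDerivAt_I_succ_of_continuousOn ih hx).continuousAt.continuousWithinAt

theorem hasDerivAt_I_succ (k : ℕ) {x : ℝ} (hx : -1 < x) : HasDerivAt (I (k + 1)) (I k x) x :=
  hasDerivAt_I_succ_of_continuousOn (continuousOn_I k) hx

theorem phi_eq (n : ℕ) (x : ℝ) :
    phi n x = (bernoulliFun (n + 1) x - (bernoulli (n + 1) : ℝ)) / (n + 1) := by
  rw [phi, bernoulliFun, Polynomial.eval_map_algebraMap]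

theorem hasDerivAt_phi (n : ℕ) (x : ℝ) : HasDerivAt (phi n) (bernoulliFun n x) x := by
  have h : phi n = fun x => (bernoulliFun (n + 1) x - (bernoulli (n + 1) : ℝ)) / (n + 1) :=
    funext (phi_eq n)
  have hn : (n : ℝ) + 1 ≠ 0 := by positivity
  rw [h]
  refine (((hasDerivAt_bernoulliFun (n + 1) x).sub_const _).div_const _).congr_deriv ?_
  rw [Nat.add_sub_cancel]
  push_cast
  field_simp

theorem hasDerivAt_psi_succ (k : ℕ) (x : ℝ) :
    HasDerivAt (psi (k + 1)) ((k + 1) * (psi k x + L k)) x := by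
  have h := HasDerivAt.fun_sum (u := Finset.range (k + 1)) fun r _ =>
    (hasDerivAt_pow (k + 1 - r) x).const_mul (((k + 1).choose r : ℝ) * L r)
  refine h.congr_deriv ?_
  have h1 : psi k x + L k =
      ∑ r ∈ Finset.range (k + 1), (k.choose r : ℝ) * L r * x ^ (k - r) := by
    rw [Finset.sum_range_succ, psi]
    simp
  rw [h1, Finset.mul_sum]
  refine Finset.sum_congr rfl fun r hr => ?_
  have hr' := Finset.mem_range.1 hr
  have h2 : (k.choose r : ℝ) * (k + 1) = (k + 1).choose r * (k + 1 - r : ℕ) := by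
    exact_mod_cast Nat.choose_mul_succ_eq k r
  rw [show k + 1 - r - 1 = k - r by omega]
  linear_combination -(L r * x ^ (k - r)) * h2

/-- The constants come out exactly right: differentiating ψ_{k+1} yields (k + 1) L_k, and the
B_{k+1} subtracted in φ_k yields H_k B_{k+1}. The factor multiplied by k + 1 is thus the formula for
ζ'(-k, w). -/
theorem hasDerivAt_logGamma_succ (k : ℕ) {w : ℝ} (hw : 0 < w) :
    HasDerivAt (logGamma (k + 1)) ((k + 1) * (harmonic k * bernoulli (k + 1) / (k + 1) - L k +
      logGamma k w) + bernoulliFun (k + 1) w / (k + 1)) w := by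
  have h1 := ((hasDerivAt_I_succ k (x := w - 1) (by linarith)).comp_sub_const w 1).const_mul
    ((k + 1).factorial : ℝ)
  have h2 := (hasDerivAt_phi (k + 1) w).const_mul (harmonic (k + 1) : ℝ)
  have h3 := (hasDerivAt_psi_succ k (w - 1)).comp_sub_const w 1
  refine ((h1.fun_add h2).fun_sub h3).congr_deriv ?_
  have hk : (k : ℝ) + 1 ≠ 0 := by positivity
  rw [logGamma, phi_eq, harmonic_succ, Nat.factorial_succ]
  push_cast
  field_simp
  ring

theorem logGamma_one (k : ℕ) : logGamma k 1 = 0 := by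
  have h1 : I k 0 = 0 := by cases k <;> simp [I]
  -- For k = 0 the factor φ_0(1) = 1 does not vanish, but H_0 does.
  have h2 : (harmonic k : ℝ) * phi k 1 = 0 := by
    cases k with
    | zero => simp
    | succ k =>
      rw [phi_eq, bernoulliFun_endpoints_eq_of_ne_one (by omega), bernoulliFun_eval_zero]
      simp
  have h3 : psi k 0 = 0 := by
    refine Finset.sum_eq_zero fun r hr => ?_
    have : k - r ≠ 0 := by have := Finset.mem_range.1 hr; omega
    simp [this]
  rw [logGamma, sub_self, h1, h2, h3]
  simp

theorem logGamma_zero (w : ℝ) : logGamma 0 w = Real.log (Real.Gamma w) := by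
  simp [logGamma, I, psi]

theorem bernoulliFun_add_one (n : ℕ) (x : ℝ) :
    bernoulliFun n (x + 1) = bernoulliFun n x + n * x ^ (n - 1) := by
  have h := congr_arg (fun p : Polynomial ℚ => Polynomial.aeval x p)
    (Polynomial.bernoulli_comp_one_add_X n)
  simp only [Polynomial.aeval_comp, map_add, map_one, Polynomial.aeval_X] at h
  simp only [bernoulliFun, Polynomial.eval_map_algebraMap]
  rw [add_comm x, h]
  simp

/-- By convexity of log Γ the derivative at x lies between the slopes over [x - 1, x] and [x, x +
1], which the functional equation evaluates. -/
theorem log_sub_one_le_deriv_log_Gamma {x : ℝ} (hx : 1 < x) :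
    Real.log (x - 1) ≤ deriv (Real.log ∘ Real.Gamma) x ∧
      deriv (Real.log ∘ Real.Gamma) x ≤ Real.log x := by
  have hrec (y : ℝ) (hy : 0 < y) :
      (Real.log ∘ Real.Gamma) (y + 1) - (Real.log ∘ Real.Gamma) y = Real.log y := by
    simp only [Function.comp]
    rw [Real.Gamma_add_one hy.ne', Real.log_mul hy.ne' (Real.Gamma_pos_of_pos hy).ne']
    ring
  have hd : DifferentiableAt ℝ (Real.log ∘ Real.Gamma) x := by
    have := (hasDerivAt_I_zero (x := x - 1) (by linarith)).comp_sub_const x 1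
    simpa [I, Function.comp_def] using this.differentiableAt
  have hc := Real.convexOn_log_Gamma
  constructor
  · have h := hc.slope_le_deriv (x := x - 1) (y := x) (Set.mem_Ioi.2 (by linarith))
      (Set.mem_Ioi.2 (by linarith)) (by linarith) hd
    rw [slope_def_field, sub_sub_cancel, div_one] at h
    have h1 := hrec (x - 1) (by linarith)
    rw [sub_add_cancel] at h1
    rwa [h1] at h
  · have h := hc.deriv_le_slope (x := x) (y := x + 1) (Set.mem_Ioi.2 (by linarith))
      (Set.mem_Ioi.2 (by linarith)) (by linarith) hd
    rwa [slope_def_field, add_sub_cancel_left, div_one, hrec x (by linarith)] at h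

theorem tendsto_deriv_log_Gamma_sub_log :
    Tendsto (fun x => deriv (Real.log ∘ Real.Gamma) x - Real.log x) atTop (𝓝 0) := by
  have h1 : Tendsto (fun x : ℝ => Real.log (1 - x⁻¹)) atTop (𝓝 0) := by
    have h2 : Tendsto (fun x : ℝ => 1 - x⁻¹) atTop (𝓝 (1 - 0)) :=
      tendsto_inv_atTop_zero.const_sub 1
    rw [sub_zero] at h2
    simpa using h2.log one_ne_zero
  refine tendsto_of_tendsto_of_tendsto_of_le_of_le' h1 tendsto_const_nhds ?_ ?_
  · filter_upwards [eventually_gt_atTop 1] with x hx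
    have h3 := (log_sub_one_le_deriv_log_Gamma hx).1
    have h4 : 1 - x⁻¹ = (x - 1) / x := by field_simp
    rw [h4, Real.log_div (by linarith) (by linarith)]
    linarith
  · filter_upwards [eventually_gt_atTop 1] with x hx
    linarith [(log_sub_one_le_deriv_log_Gamma hx).2]

/-! ### Identification of ζ'(-k, w) by induction on k, and consequences -/

theorem deriv_hurwitz_neg_nat (k : ℕ) {w : ℝ} (hw : 0 < w) : deriv (hurwitz w) (-(k : ℂ)) =
    ((harmonic k * bernoulli (k + 1) / (k + 1) - L k + logGamma k w : ℝ) : ℂ) := by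
  induction k generalizing w with
  | zero =>
    refine deriv_hurwitz_eq_of_difference_equation 0
      (g := fun w => harmonic 0 * bernoulli (0 + 1) / ((0 : ℕ) + 1) - L 0 + logGamma 0 w)
      (g' := fun w => deriv (Real.log ∘ Real.Gamma) w) (C := 0)
      ?_ (fun w hw => ?_) (fun w hw => hasDerivAt_stirlingMain_zero hw) ?_ (fun w hw => ?_) hw
    · rw [deriv_riemannZeta_neg_nat]
      simp only [logGamma_one, add_zero]
    · have h := (hasDerivAt_I_zero (x := w - 1) (by linarith)).comp_sub_const w 1
      rw [sub_add_cancel] at h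
      refine HasDerivAt.const_add _ (h.congr_of_eventuallyEq (.of_forall fun x => ?_))
      simp [logGamma_zero, I]
    · have h := tendsto_deriv_log_Gamma_sub_log.add
        (tendsto_inv_atTop_zero.const_mul (1 / 2 : ℝ))
      rw [mul_zero, add_zero] at h
      exact h.congr fun x => by ring
    · simp only [logGamma_zero]
      rw [Real.Gamma_add_one hw.ne', Real.log_mul hw.ne' (Real.Gamma_pos_of_pos hw).ne']
      ring
  | succ k ih =>
    set g : ℝ → ℝ := fun w =>
      harmonic (k + 1) * bernoulli (k + 1 + 1) / ((k + 1 : ℕ) + 1) - L (k + 1) +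
        logGamma (k + 1) w with hg
    set r : ℝ → ℝ := fun w => harmonic k * bernoulli (k + 1) / (k + 1) - L k + logGamma k w with hr
    have hk : (k : ℝ) + 1 ≠ 0 := by positivity
    have hgd (w : ℝ) (hw : 0 < w) :
        HasDerivAt g ((k + 1) * r w + bernoulliFun (k + 1) w / (k + 1)) w :=
      (hasDerivAt_logGamma_succ k hw).const_add _
    have hrdiff (w : ℝ) (hw : 0 < w) : r (w + 1) = r w + w ^ k * Real.log w := by
      have h := deriv_hurwitz_add_one k hw
      rw [ih hw, ih (by linarith), ← Complex.ofReal_add] at h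
      exact Complex.ofReal_injective h
    -- The defect in the difference equation has zero derivative, by the level-k difference equation
    -- and B_{k+1}(w + 1) - B_{k+1}(w) = (k + 1) w^k. Its constant value C is left undetermined; the
    -- characterisation forces it to be 0.
    have hconst : ∃ C, ∀ w, 0 < w → g (w + 1) - g w - w ^ (k + 1) * Real.log w = C := by
      have hd (w : ℝ) (hw : 0 < w) :
          HasDerivAt (fun w => g (w + 1) - g w - w ^ (k + 1) * Real.log w) 0 w := by
        refine ((((hgd (w + 1) (by linarith)).comp_add_const w 1).fun_sub (hgd w hw)).fun_sub
          ((hasDerivAt_pow (k + 1) w).fun_mul (Real.hasDerivAt_log hw.ne'))).congr_deriv ?_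
        rw [hrdiff w hw, bernoulliFun_add_one, Nat.add_sub_cancel]
        push_cast
        field_simp
        ring
      obtain ⟨C, hC⟩ := isOpen_Ioi.exists_is_const_of_deriv_eq_zero (isPreconnected_Ioi (a := (0 : ℝ)))
        (fun w hw => (hd w hw).differentiableAt.differentiableWithinAt)
        (fun w hw => (hd w hw).deriv)
      exact ⟨C, fun w hw => hC w hw⟩
    obtain ⟨C, hC⟩ := hconst
    refine deriv_hurwitz_eq_of_difference_equation (k + 1) (g := g) (C := C)
      ?_ hgd (fun w hw => hasDerivAt_stirlingMain_succ k hw) ?_ (fun w hw => ?_) hw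
    · rw [deriv_riemannZeta_neg_nat]
      simp only [hg, logGamma_one, add_zero]
    · have h1 : Tendsto (fun w => r w - stirlingMain k w) atTop (𝓝 0) := by
        have h2 := (Complex.continuous_re.tendsto _).comp
          (tendsto_deriv_hurwitz_sub_stirlingMain k)
        refine h2.congr' ?_
        filter_upwards [eventually_gt_atTop 0] with w hw
        simp only [Function.comp]
        rw [ih hw, ← Complex.ofReal_sub, Complex.ofReal_re]
      have h3 := (h1.const_mul ((k : ℝ) + 1)).sub
        (tendsto_inv_atTop_zero.const_mul ((bernoulli (k + 2) : ℝ) / (k + 2)))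
      rw [mul_zero, mul_zero, sub_zero] at h3
      exact h3.congr fun w => by ring
    · linarith [hC w hw]

/-- Inherited from the difference equation of ζ'(-k, w), in which the constants cancel. -/
theorem logGamma_add_one (k : ℕ) {w : ℝ} (hw : 0 < w) :
    logGamma k (w + 1) = logGamma k w + w ^ k * Real.log w := by
  have h := deriv_hurwitz_add_one k hw
  rw [deriv_hurwitz_neg_nat k hw, deriv_hurwitz_neg_nat k (by linarith), ← Complex.ofReal_add] at h
  linarith [Complex.ofReal_injective h]

theorem logGamma_natCast_add_one (k n : ℕ) : logGamma k (n + 1) = logGammaNat k n := by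
  induction n with
  | zero => simp [logGamma_one, logGammaNat]
  | succ n ih =>
    push_cast
    rw [logGamma_add_one k (by positivity), ih, logGammaNat_succ]

/-- The difference equation replaces Λ_k(x + 1) by Λ_k(x) + x^k log x, so nothing has to be
re-expanded in x + 1; and Λ_k(x) is ζ'(-k, x) minus exactly the constant coefficient of
`stirlingMain`. -/
theorem hasConstantTerm_Lam (k : ℕ) :
    HasConstantTerm atTop (fun x : ℝ => x) (fun x : ℝ => Lam k (x + 1)) 0 := by
  have h1 := ((Complex.continuous_re.tendsto _).comp
    (tendsto_deriv_hurwitz_sub_stirlingMain k)).sub_const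
      (harmonic k * bernoulli (k + 1) / (k + 1) : ℝ)
  have h2 := hasConstantTerm_of_tendsto_sub_stirlingMain (x := fun x : ℝ => x)
    (f := fun x : ℝ => Lam k (x + 1)) k (h1.congr' ?_)
  · simpa using h2
  · filter_upwards [eventually_gt_atTop 0] with w hw
    simp only [Function.comp]
    rw [deriv_hurwitz_neg_nat k hw, ← Complex.ofReal_sub, Complex.ofReal_re, Lam,
      logGamma_add_one k hw]
    ring

end GKB

theorem mainTheorem1 (k : ℕ) :
    -- the constant term `L_k` of `∑_{m ≤ n} m^k log m` exists
    GKB.HasConstantTerm atTop (fun n : ℕ => (n : ℝ)) (GKB.logGammaNat k) (GKB.L k) ∧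
    -- `log Γ_k` interpolates the sums `∑_{m ≤ n} m^k log m`
    (∀ n : ℕ, GKB.logGamma k ((n : ℝ) + 1) = ∑ m ∈ Finset.Icc 1 n, (m : ℝ) ^ k * Real.log m) ∧
    -- `log Γ_k(x + 1) = L_k + Λ_k(x + 1)`, with no constant term in `Λ_k(x + 1)` as `x → ∞`
    (∀ x : ℝ, -1 < x → GKB.logGamma k (x + 1) = GKB.L k + GKB.Lam k (x + 1)) ∧
    GKB.HasConstantTerm atTop (fun x : ℝ => x) (fun x : ℝ => GKB.Lam k (x + 1)) 0 ∧
    -- `ζ'(-k) = H_k B_{k+1} / (k + 1) - log A_k`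
    HasDerivAt riemannZeta
      (((harmonic k : ℝ) * (bernoulli (k + 1) : ℝ) / ((k : ℝ) + 1) - Real.log (GKB.A k) : ℝ) : ℂ)
      (-(k : ℂ)) ∧
    ∀ w : ℝ, 0 < w →
      -- `ζ'(-k, w) - ζ'(-k) = log Γ_k(w)`
      deriv (GKB.hurwitz w) (-(k : ℂ)) - deriv riemannZeta (-(k : ℂ)) =
        (GKB.logGamma k w : ℂ) ∧
      -- `ζ'(-k, w) = H_k B_{k+1} / (k + 1) - L_k + log Γ_k(w)`
      HasDerivAt (GKB.hurwitz w)
        (((harmonic k : ℝ) * (bernoulli (k + 1) : ℝ) / ((k : ℝ) + 1) - GKB.L k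
          + GKB.logGamma k w : ℝ) : ℂ) (-(k : ℂ)) ∧
      -- `ζ'(-k, w) = H_k B_{k+1} / (k + 1) + Λ_k(w)`
      HasDerivAt (GKB.hurwitz w)
        (((harmonic k : ℝ) * (bernoulli (k + 1) : ℝ) / ((k : ℝ) + 1) + GKB.Lam k w : ℝ) : ℂ)
        (-(k : ℂ)) := by
  have hdz : DifferentiableAt ℂ riemannZeta (-(k : ℂ)) :=
    differentiableAt_riemannZeta (GKB.neg_natCast_ne_one k)
  refine ⟨GKB.hasConstantTerm_logGammaNat k, GKB.logGamma_natCast_add_one k,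
    fun x _ => by rw [GKB.Lam]; ring, GKB.hasConstantTerm_Lam k, ?_, fun w hw => ?_⟩
  · rw [GKB.A, Real.log_exp, ← GKB.deriv_riemannZeta_neg_nat]
    exact hdz.hasDerivAt
  · have hd : HasDerivAt (GKB.hurwitz w) _ (-(k : ℂ)) :=
      (GKB.differentiableAt_hurwitz (GKB.neg_natCast_ne_one k)).hasDerivAt
    rw [GKB.deriv_hurwitz_neg_nat k hw] at hd
    refine ⟨?_, hd, ?_⟩
    · rw [GKB.deriv_hurwitz_neg_nat k hw, GKB.deriv_riemannZeta_neg_nat, ← Complex.ofReal_sub]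
      congr 1
      ring
    · rw [GKB.Lam]
      convert hd using 2
      ring
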